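/- Let $\Bbbk$ be a field of characteristic $0$, let $\mathcal F$ be an associative (not necessarily unital) $\Bbbk$-algebra, and write $\otimes=\otimes_\Bbbk$. For subspaces $P,Q$ of an associative algebra, $PQ$ and $[P,Q]$ denote the linear spans of all $pq$, respectively of all $pq-qp$, with $p\in P$, $q\in Q$. Put $\mathcal F^{(0)}=\mathcal F$, $\mathcal F^{(k+1)}=[\mathcal F,\mathcal F^{(k)}]$, and $$I_k(\mathcal F)=\sum_{\ell\ge 1}\ \sum_{\lambda_1+\cdots+\lambda_\ell=k}\mathcal F^{(\lambda_1)}\mathcal F^{(\lambda_2)}\cdots\mathcal F^{(\lambda_\ell)}\qquad(k\ge 0,\ \lambda_i\in\mathbb Z_{\ge 0}).$$ For a unital associative $\Bbbk$-algebra $A$ and subspaces $P\subseteq\mathcal F$, $X\subseteq A$, let $P\cdot X\subseteq\mathcal F\otimes A$ be the span of all $f\otimes x$ with $f\in P$, $x\in X$; for $W\subseteq\mathcal F\otimes A$ let $W\cdot X$ be the span of all $w\cdot x$ with $w\in W$, $x\in X$, where $(f\otimes a)\cdot x=f\otimes ax$. For a Lie subalgebra $\mathfrak g\subseteq A$ (under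 the commutator), let $(\mathfrak g,A)(\mathcal F)$ be the Lie subalgebra of $\mathcal F\otimes A$ (under the commutator) generated by $\mathcal F\cdot\mathfrak g$. **Theorem.** (1) Let $A$ be a unital associative $\Bbbk$-algebra containing $sl_2(\Bbbk)$ as a Lie subalgebra, with standard basis $E,F,H$ ($[E,F]=H$, $[H,E]=2E$, $[H,F]=-2F$). Then $$(sl_2(\Bbbk),A)(\mathcal F)=\mathcal F\cdot sl_2(\Bbbk)+[\mathcal F\cdot\Delta,\,Z_1(A,\mathcal F)]+\sum_{i\ge 1}Z_i(A,\mathcal F)\cdot V_{2i},$$ where $\Delta=2EF+2FE+H^2\in A$ is the Casimir element, $Z_i(A,\mathcal F)=\sum_{j\ge 0}I_{i+2j-1}(\mathcal F)\cdot\Delta^j$ for $i\ge1$, and $V_{2i}\subseteq A$ is the $sl_2(\Bbbk)$-submodule (for the adjoint action) generated by $E^i$. Here $[\mathcal F\cdot\Delta,\,Z_1(A,\mathcal F)]=\sum_{j\ge1}[\mathcal F,I_{2j-2}(\mathcal F)]\cdot\Delta^{j}$. (2) In particular, if $m\ge 1$ and $A=\mathrm{End}_\Bbbk(V)$, where $V$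 is a simple $sl_2(\Bbbk)$-module of dimension $m+1$, then $$(sl_2(\Bbbk),A)(\mathcal F)=[\mathcal F,\mathcal F]\cdot 1+\sum_{k=1}^m I_{k-1}(\mathcal F)\cdot V_{2k},$$ where $sl_2(\Bbbk)$ is identified with its image in $\mathrm{End}_\Bbbk(V)$. -/

import Mathlib

open scoped TensorProduct

attribute [local instance 100] LieRing.ofAssociativeRing

namespace NCurrent

noncomputable section

section Commutators

variable {𝕜 : Type*} [Field 𝕜] {R : Type*} [NonUnitalRing R] [Module 𝕜 R]

/-- The linear span `[M, N]` of all commutators `a * b - b * a` with `a ∈ M`, `b ∈ N`. -/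
def comm (M N : Submodule 𝕜 R) : Submodule 𝕜 R :=
  Submodule.span 𝕜 {x | ∃ a ∈ M, ∃ b ∈ N, x = a * b - b * a}

/-- The Lie subalgebra (for the commutator bracket) generated by a subspace `S`: the smallest
subspace that contains `S` and is closed under commutators. -/
def lieGenerated (S : Submodule 𝕜 R) : Submodule 𝕜 R :=
  sInf {L | S ≤ L ∧ ∀ a ∈ L, ∀ b ∈ L, a * b - b * a ∈ L}

end Commutators

section Ideals

variable (𝕜 : Type*) [Field 𝕜] (F : Type*) [NonUnitalRing F] [Module 𝕜 F]
  [IsScalarTower 𝕜 F F] [SMulCommClass 𝕜 F F]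

/-- The commutator spaces `F⁽⁰⁾ = F`, `F⁽ᵏ⁺¹⁾ = [F, F⁽ᵏ⁾]`. -/
def commSpace : ℕ → Submodule 𝕜 F
  | 0 => ⊤
  | k + 1 => comm ⊤ (commSpace k)

/-- The product `F⁽ᵃ⁾ F⁽ᵇ⁾ F⁽ᶜ⁾ ⋯` over the nonempty list `a, b, c, …` of exponents, where `P Q` is
the span of all `x * y` with `x ∈ P`, `y ∈ Q`. -/
def commProd : ℕ → List ℕ → Submodule 𝕜 F
  | a, [] => commSpace 𝕜 F a
  | a, b :: l => Submodule.map₂ (LinearMap.mul 𝕜 F) (commSpace 𝕜 F a) (commProd b l)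

/-- `I_k(F)`: the sum of the products `F⁽ᵃ¹⁾ ⋯ F⁽ᵃˡ⁾` over all `l ≥ 1` and all
`a₁, …, aₗ ≥ 0` with `a₁ + ⋯ + aₗ = k`. -/
def idealI (k : ℕ) : Submodule 𝕜 F :=
  ⨆ (a : ℕ) (l : List ℕ) (_ : a + l.sum = k), commProd 𝕜 F a l

end Ideals

section Tensor

variable {𝕜 : Type*} [Field 𝕜] {F : Type*} [NonUnitalRing F] [Module 𝕜 F]
  {A : Type*} [Ring A] [Algebra 𝕜 A]

/-- `P · X ⊆ F ⊗ A`: the span of all `f ⊗ x` with `f ∈ P`, `x ∈ X`. -/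
def dot (P : Submodule 𝕜 F) (X : Submodule 𝕜 A) : Submodule 𝕜 (F ⊗[𝕜] A) :=
  Submodule.map₂ (TensorProduct.mk 𝕜 F A) P X

/-- `W · X ⊆ F ⊗ A` for `W ⊆ F ⊗ A` and `X ⊆ A`: the span of all `w · x`, where
`(f ⊗ a) · x = f ⊗ (a * x)`. (Here `F` need not have a unit.) -/
def rdot (W : Submodule 𝕜 (F ⊗[𝕜] A)) (X : Submodule 𝕜 A) : Submodule 𝕜 (F ⊗[𝕜] A) :=
  Submodule.span 𝕜 {y | ∃ w ∈ W, ∃ x ∈ X, y = (LinearMap.mulRight 𝕜 x).lTensor F w}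

end Tensor

/-- `(𝔤, A)(F)`: the Lie subalgebra of `F ⊗ A` generated by `F · 𝔤`, for a Lie subalgebra `𝔤`
of `A`. -/
def current {𝕜 : Type*} [Field 𝕜] {A : Type*} [Ring A] [Algebra 𝕜 A]
    (𝔤 : LieSubalgebra 𝕜 A) (F : Type*) [NonUnitalRing F] [Module 𝕜 F]
    [IsScalarTower 𝕜 F F] [SMulCommClass 𝕜 F F] : Submodule 𝕜 (F ⊗[𝕜] A) :=
  lieGenerated (dot (⊤ : Submodule 𝕜 F) 𝔤.toSubmodule)

section SlTwo

variable (𝕜 : Type*) [Field 𝕜]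

/-- The Lie algebra `sl₂(𝕜)` of traceless `2 × 2` matrices. -/
abbrev Sl2 : Type _ := LieAlgebra.SpecialLinear.sl (Fin 2) 𝕜

/-- `E = (0 1; 0 0)`. -/
def slE : Sl2 𝕜 := LieAlgebra.SpecialLinear.single 0 1 (by decide) 1

/-- `F = (0 0; 1 0)`. -/
def slF : Sl2 𝕜 := LieAlgebra.SpecialLinear.single 1 0 (by decide) 1

/-- `H = (1 0; 0 -1)`. -/
def slH : Sl2 𝕜 := LieAlgebra.SpecialLinear.singleSubSingle 0 1 1

variable {𝕜} {A : Type*} [Ring A] [Algebra 𝕜 A] (φ : Sl2 𝕜 →ₗ⁅𝕜⁆ A)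

/-- The Casimir element `Δ = 2EF + 2FE + H²` of `A`, for `sl₂(𝕜)` mapped to `A` by `φ`. -/
def casimir : A :=
  2 * (φ (slE 𝕜) * φ (slF 𝕜)) + 2 * (φ (slF 𝕜) * φ (slE 𝕜)) + φ (slH 𝕜) ^ 2

/-- `V_{2i}`: the `sl₂(𝕜)`-submodule of `A` (under the adjoint action) generated by `Eⁱ`. -/
def subV (i : ℕ) : Submodule 𝕜 A :=
  (LieSubmodule.lieSpan 𝕜 φ.range {φ (slE 𝕜) ^ i} : LieSubmodule 𝕜 φ.range A).toSubmodule

/-- `Z_i(A, F) = ∑_{j ≥ 0} I_{i+2j-1}(F) · Δʲ`, for `i ≥ 1`. -/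
def subZ (F : Type*) [NonUnitalRing F] [Module 𝕜 F] [IsScalarTower 𝕜 F F]
    [SMulCommClass 𝕜 F F] (i : ℕ) : Submodule 𝕜 (F ⊗[𝕜] A) :=
  ⨆ j : ℕ, dot (idealI 𝕜 F (i + 2 * j - 1)) (𝕜 ∙ (casimir φ ^ j))

end SlTwo

end

end NCurrent

/-!
Write `L = (sl₂, A)(F)`, `Δ` for the Casimir element, and `I_k = I_k(F)`. The spaces `I_k` are
decreasing two-sided ideals with `[F, I_k] ⊆ I_{k+1}`. The bracket
`2 [f ⊗ x, q ⊗ v] = [f, q] ⊗ {x, v} + {f, q} ⊗ [x, v]` (with `{ , }` the anticommutator) reduces the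
theorem to two facts.

* In `A`, the anticommutators of `sl₂` with `V_{2n}` lie in `V_{2n+2} + (Δ - (n² - 1)) V_{2n-2}`
  (`anticommutator_mem`). By equivariance this only has to be checked on `Eⁿ`, where it is an
  identity in normally ordered monomials (`anticommutator_f_e_pow`). As `I_k` decreases, the scalar
  `n² - 1` does no harm, so the right-hand side (`explicitForm`) is stable under brackets with
  `F · sl₂` and hence contains `L` (`current_le_explicitForm`).
* In `F`, the space `I_{k+1}` is the left ideal generated by `[F, I_k]`
  (`commProd_le_leftIdeal`), hence the closure of `[F, I_k]` under anticommutators with `F`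
  (`idealI_succ_le_of_anticommutator`). Now consider the `q ∈ F` with `q ⊗ Δʲ Eⁿ ∈ L`
  (`coeffSpace`). As `L` is stable under `1 ⊗ ad sl₂`, such `q` satisfy `q ⊗ Δʲ V_{2n} ⊆ L`.
  Bracketing with `f ⊗ E` puts `[f, q] ⊗ Δʲ Eⁿ⁺¹` into `L`, then bracketing with `f ⊗ H` puts
  `{f, q} ⊗ Δʲ Eⁿ` into `L`, and then bracketing with `f` times the lowering element of `sl₂` puts
  `[f, q] ⊗ Δʲ (Δ - (n² - 1)) Eⁿ⁻¹` into `L`. Induction on `j`, and on `n` for `j = 0`, gives the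
  opposite inclusion (`explicitForm_le_current`).

On a simple module of dimension `m + 1 ≥ 2`, `Δ` acts by a nonzero scalar
(`exists_casimir_eq_smul_one`) and `Eᵐ⁺¹ = 0`, so the second assertion is read off from the first.
-/

namespace NCurrent

/-! ### Commutator spaces and generated Lie subalgebras -/

section Commutators

variable {𝕜 : Type*} [Field 𝕜] {R : Type*} [NonUnitalRing R] [Module 𝕜 R]

theorem commutator_mem_comm {M N : Submodule 𝕜 R} {a b : R} (ha : a ∈ M) (hb : b ∈ N) :
    a * b - b * a ∈ comm M N :=
  Submodule.subset_span ⟨a, ha, b, hb, rfl⟩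

theorem comm_le {M N P : Submodule 𝕜 R} :
    comm M N ≤ P ↔ ∀ a ∈ M, ∀ b ∈ N, a * b - b * a ∈ P := by
  refine ⟨fun h a ha b hb => h (commutator_mem_comm ha hb), fun h => Submodule.span_le.2 ?_⟩
  rintro _ ⟨a, ha, b, hb, rfl⟩
  exact h a ha b hb

theorem comm_mono {M M' N N' : Submodule 𝕜 R} (hM : M ≤ M') (hN : N ≤ N') :
    comm M N ≤ comm M' N' :=
  comm_le.2 fun _ ha _ hb => commutator_mem_comm (hM ha) (hN hb)

theorem subset_lieGenerated (S : Submodule 𝕜 R) : S ≤ lieGenerated S :=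
  le_sInf fun _ h => h.1

theorem commutator_mem_lieGenerated {S : Submodule 𝕜 R} {a b : R}
    (ha : a ∈ lieGenerated S) (hb : b ∈ lieGenerated S) : a * b - b * a ∈ lieGenerated S := by
  simp only [lieGenerated, Submodule.mem_sInf] at *
  exact fun L hL => hL.2 a (ha L hL) b (hb L hL)

theorem lieGenerated_le {S L : Submodule 𝕜 R} (hS : S ≤ L)
    (hL : ∀ a ∈ L, ∀ b ∈ L, a * b - b * a ∈ L) : lieGenerated S ≤ L :=
  sInf_le ⟨hS, hL⟩

/-- A derivation that maps `S` into the Lie subalgebra generated by `S` preserves the latter. -/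
theorem derivation_mem_lieGenerated {S : Submodule 𝕜 R} (D : R →ₗ[𝕜] R)
    (hD : ∀ a b, D (a * b) = D a * b + a * D b) (hS : ∀ s ∈ S, D s ∈ lieGenerated S)
    {x : R} (hx : x ∈ lieGenerated S) : D x ∈ lieGenerated S := by
  suffices h : lieGenerated S ≤ lieGenerated S ⊓ (lieGenerated S).comap D from (h hx).2
  refine lieGenerated_le (le_inf (subset_lieGenerated S) hS) ?_
  rintro a ⟨ha, ha'⟩ b ⟨hb, hb'⟩
  refine ⟨commutator_mem_lieGenerated ha hb, ?_⟩
  have e : D (a * b - b * a) = (D a * b - b * D a) + (a * D b - D b * a) := by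
    rw [map_sub, hD, hD]; abel
  change D (a * b - b * a) ∈ lieGenerated S
  rw [e]
  exact Submodule.add_mem _ (commutator_mem_lieGenerated ha' hb)
    (commutator_mem_lieGenerated ha hb')

variable [IsScalarTower 𝕜 R R] [SMulCommClass 𝕜 R R]

/-- The commutator `x ↦ a * x - x * a`, as a linear map. -/
def adL (a : R) : R →ₗ[𝕜] R := LinearMap.mulLeft 𝕜 a - LinearMap.mulRight 𝕜 a

@[simp] theorem adL_apply (a x : R) : adL (𝕜 := 𝕜) a x = a * x - x * a := rfl

/-- A subspace containing `S` contains the Lie subalgebra generated by `S` as soon as it is stable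
under commutators with elements of `S`: its elements that normalize it form a Lie subalgebra. -/
theorem lieGenerated_le_of_stable {S P : Submodule 𝕜 R} (hS : S ≤ P)
    (h : ∀ s ∈ S, ∀ p ∈ P, s * p - p * s ∈ P) : lieGenerated S ≤ P := by
  let N : Submodule 𝕜 R :=
    { carrier := {x | x ∈ P ∧ ∀ p ∈ P, x * p - p * x ∈ P}
      add_mem' := by
        rintro x y ⟨hx, hx'⟩ ⟨hy, hy'⟩
        refine ⟨P.add_mem hx hy, fun p hp => ?_⟩
        have e : (x + y) * p - p * (x + y) = (x * p - p * x) + (y * p - p * y) := by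
          simp only [add_mul, mul_add]; abel
        rw [e]
        exact P.add_mem (hx' p hp) (hy' p hp)
      zero_mem' := ⟨P.zero_mem, fun p _ => by simp⟩
      smul_mem' := by
        rintro c x ⟨hx, hx'⟩
        refine ⟨P.smul_mem c hx, fun p hp => ?_⟩
        rw [smul_mul_assoc, mul_smul_comm, ← smul_sub]
        exact P.smul_mem c (hx' p hp) }
  have hN : lieGenerated S ≤ N := by
    refine lieGenerated_le (fun s hs => ⟨hS hs, h s hs⟩) ?_
    rintro a ⟨ha, ha'⟩ b ⟨hb, hb'⟩
    refine ⟨ha' b hb, fun p hp => ?_⟩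
    have e : (a * b - b * a) * p - p * (a * b - b * a)
        = (a * (b * p - p * b) - (b * p - p * b) * a)
          - (b * (a * p - p * a) - (a * p - p * a) * b) := by
      simp only [mul_sub, sub_mul, mul_assoc]; abel
    rw [e]
    exact P.sub_mem (ha' _ (hb' p hp)) (hb' _ (ha' p hp))
  exact fun x hx => (hN hx).1

end Commutators

/-! ### The ideals `I_k(F)` -/

section Ideals

variable {𝕜 : Type*} [Field 𝕜] {F : Type*} [NonUnitalRing F] [Module 𝕜 F]
  [IsScalarTower 𝕜 F F] [SMulCommClass 𝕜 F F]

theorem commProd_le_idealI {k a : ℕ} {l : List ℕ} (h : a + l.sum = k) :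
    commProd 𝕜 F a l ≤ idealI 𝕜 F k :=
  le_iSup_of_le a (le_iSup_of_le l (le_iSup_of_le h le_rfl))

theorem idealI_le {k : ℕ} {P : Submodule 𝕜 F}
    (h : ∀ a l, a + l.sum = k → commProd 𝕜 F a l ≤ P) : idealI 𝕜 F k ≤ P :=
  iSup_le fun a => iSup_le fun l => iSup_le fun hk => h a l hk

theorem mul_mem_commProd {a b : ℕ} {l : List ℕ} {x y : F} (hx : x ∈ commSpace 𝕜 F a)
    (hy : y ∈ commProd 𝕜 F b l) : x * y ∈ commProd 𝕜 F a (b :: l) :=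
  Submodule.apply_mem_map₂ (LinearMap.mul 𝕜 F) hx hy

theorem commProd_cons_le {a b : ℕ} {l : List ℕ} {P : Submodule 𝕜 F} :
    commProd 𝕜 F a (b :: l) ≤ P ↔
      ∀ x ∈ commSpace 𝕜 F a, ∀ y ∈ commProd 𝕜 F b l, x * y ∈ P :=
  Submodule.map₂_le

theorem commSpace_le_idealI (k : ℕ) : commSpace 𝕜 F k ≤ idealI 𝕜 F k :=
  commProd_le_idealI (a := k) (l := []) (by simp)

theorem idealI_zero : idealI 𝕜 F 0 = ⊤ :=
  top_le_iff.1 (commSpace_le_idealI 0)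

theorem mul_mem_idealI {k : ℕ} (f : F) {p : F} (hp : p ∈ idealI 𝕜 F k) :
    f * p ∈ idealI 𝕜 F k := by
  suffices h : idealI 𝕜 F k ≤ (idealI 𝕜 F k).comap (LinearMap.mulLeft 𝕜 f) from h hp
  refine idealI_le fun a l hk p hp => ?_
  exact commProd_le_idealI (a := 0) (l := a :: l) (by simpa using hk)
    (mul_mem_commProd (a := 0) (x := f) Submodule.mem_top hp)

theorem commProd_mul_mem {a : ℕ} {l : List ℕ} {p : F} (hp : p ∈ commProd 𝕜 F a l) (f : F) :
    p * f ∈ commProd 𝕜 F a (l ++ [0]) := by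
  induction l generalizing a p with
  | nil => exact mul_mem_commProd (b := 0) (l := []) hp (y := f) Submodule.mem_top
  | cons b l ih =>
    suffices h : commProd 𝕜 F a (b :: l) ≤
        (commProd 𝕜 F a (b :: l ++ [0])).comap (LinearMap.mulRight 𝕜 f) from h hp
    refine commProd_cons_le.2 fun x hx y hy => ?_
    change x * y * f ∈ commProd 𝕜 F a (b :: l ++ [0])
    rw [mul_assoc]
    exact mul_mem_commProd hx (ih hy)

theorem idealI_mul_mem {k : ℕ} {p : F} (hp : p ∈ idealI 𝕜 F k) (f : F) :
    p * f ∈ idealI 𝕜 F k := by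
  suffices h : idealI 𝕜 F k ≤ (idealI 𝕜 F k).comap (LinearMap.mulRight 𝕜 f) from h hp
  refine idealI_le fun a l hk p hp => ?_
  exact commProd_le_idealI (by simpa using hk) (commProd_mul_mem hp f)

/-- The Leibniz rule for a commutator with a product `F⁽ᵃ¹⁾ ⋯ F⁽ᵃˡ⁾`: it is a sum of products with
the same number of factors, in which one exponent went up by one. -/
theorem commutator_commProd_mem {a : ℕ} {l : List ℕ} {P : Submodule 𝕜 F}
    (hP : ∀ a' l', l'.length = l.length → a' + l'.sum = a + l.sum + 1 → commProd 𝕜 F a' l' ≤ P)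
    (f : F) {p : F} (hp : p ∈ commProd 𝕜 F a l) : f * p - p * f ∈ P := by
  induction l generalizing a p P with
  | nil =>
    exact hP (a + 1) [] rfl (by simp) (commutator_mem_comm (Submodule.mem_top (x := f)) hp)
  | cons b l ih =>
    suffices h : commProd 𝕜 F a (b :: l) ≤ P.comap (adL f) from h hp
    refine commProd_cons_le.2 fun x hx y hy => ?_
    have e : f * (x * y) - x * y * f = (f * x - x * f) * y + x * (f * y - y * f) := by
      simp only [mul_sub, sub_mul, mul_assoc]; abel
    change f * (x * y) - x * y * f ∈ P
    rw [e]
    refine P.add_mem (hP (a + 1) (b :: l) rfl (by ring)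
      (mul_mem_commProd (commutator_mem_comm (Submodule.mem_top (x := f)) hx) hy)) ?_
    refine ih (P := P.comap (LinearMap.mulLeft 𝕜 x)) (fun a' l' h1 h2 z hz => ?_) hy
    exact hP a (a' :: l') (by simp [h1]) (by simp only [List.sum_cons]; omega)
      (mul_mem_commProd hx hz)

theorem commutator_mem_idealI {k : ℕ} (f : F) {p : F} (hp : p ∈ idealI 𝕜 F k) :
    f * p - p * f ∈ idealI 𝕜 F (k + 1) := by
  suffices h : idealI 𝕜 F k ≤ (idealI 𝕜 F (k + 1)).comap (adL f) from h hp
  refine idealI_le fun a l hk p hp => ?_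
  change f * p - p * f ∈ idealI 𝕜 F (k + 1)
  refine commutator_commProd_mem (fun a' l' _ h => ?_) f hp
  exact commProd_le_idealI (by omega)

/-- If a product `F⁽ᵃ¹⁾ ⋯ F⁽ᵃˡ⁾` has total exponent `w + 1`, then it lies in the left ideal
generated by `[F, I_w(F)]`. Pulling a commutator out of the first factor with positive exponent
costs terms in which an exponent moves to the right, so that one can induct on the number of
factors and on the first exponent. -/
theorem commProd_le_leftIdeal (w a : ℕ) (l : List ℕ) (h : a + l.sum = w + 1) :
    commProd 𝕜 F a l ≤ comm ⊤ (idealI 𝕜 F w) ⊔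
      Submodule.map₂ (LinearMap.mul 𝕜 F) ⊤ (comm ⊤ (idealI 𝕜 F w)) := by
  obtain ⟨n, hn⟩ : ∃ n, l.length = n := ⟨_, rfl⟩
  set C : Submodule 𝕜 F := comm ⊤ (idealI 𝕜 F w) with hC
  set K := C ⊔ Submodule.map₂ (LinearMap.mul 𝕜 F) ⊤ C with hK
  have hmul : ∀ x, ∀ y ∈ K, x * y ∈ K := by
    intro x y hy
    suffices h : K ≤ K.comap (LinearMap.mulLeft 𝕜 x) from h hy
    refine sup_le (fun c hc => ?_) (Submodule.map₂_le.2 fun f _ c hc => ?_)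
    · exact (le_sup_right : _ ≤ K)
        (Submodule.apply_mem_map₂ (LinearMap.mul 𝕜 F) Submodule.mem_top hc)
    · change x * (f * c) ∈ K
      rw [← mul_assoc]
      exact (le_sup_right : _ ≤ K)
        (Submodule.apply_mem_map₂ (LinearMap.mul 𝕜 F) Submodule.mem_top hc)
  induction n generalizing a l with
  | zero =>
    obtain rfl : l = [] := List.length_eq_zero_iff.1 hn
    obtain rfl : a = w + 1 := by simpa using h
    exact (comm_mono le_rfl (commSpace_le_idealI w)).trans le_sup_left
  | succ n ihn =>
    induction a generalizing l with
    | zero =>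
      obtain ⟨b, l, rfl⟩ : ∃ b l', l = b :: l' := List.exists_cons_of_length_eq_add_one hn
      refine commProd_cons_le.2 fun x _ y hy => hmul x y ?_
      exact ihn b l (by simpa using h) (by simpa using hn) hy
    | succ a iha =>
      obtain ⟨b, l, rfl⟩ : ∃ b l', l = b :: l' := List.exists_cons_of_length_eq_add_one hn
      refine commProd_cons_le.2 fun x hx y hy => ?_
      suffices h' : commSpace 𝕜 F (a + 1) ≤ K.comap (LinearMap.mulRight 𝕜 y) from h' hx
      refine comm_le.2 fun f _ p hp => ?_
      change (f * p - p * f) * y ∈ K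
      have e : (f * p - p * f) * y = (f * (p * y) - p * y * f) - p * (f * y - y * f) := by
        simp only [mul_sub, sub_mul, mul_assoc]; abel
      simp only [List.sum_cons] at h
      rw [e]
      refine K.sub_mem ((le_sup_left : _ ≤ K) (commutator_mem_comm Submodule.mem_top
        (commProd_le_idealI (a := a) (l := b :: l) (by simp only [List.sum_cons]; omega)
          (mul_mem_commProd hp hy)))) ?_
      refine commutator_commProd_mem (P := K.comap (LinearMap.mulLeft 𝕜 p))
        (fun a' l' h1 h2 z hz => ?_) f hy
      exact iha (a' :: l') (by simp only [List.sum_cons]; omega)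
        (by simpa [h1] using hn) (mul_mem_commProd hp hz)

theorem idealI_succ_le (k : ℕ) : idealI 𝕜 F (k + 1) ≤ idealI 𝕜 F k := by
  have h : comm ⊤ (idealI 𝕜 F k) ≤ idealI 𝕜 F k :=
    comm_le.2 fun f _ p hp => Submodule.sub_mem _ (mul_mem_idealI f hp) (idealI_mul_mem hp f)
  refine idealI_le fun a l hk => (commProd_le_leftIdeal k a l hk).trans (sup_le h ?_)
  exact Submodule.map₂_le.2 fun f _ p hp => mul_mem_idealI f (h hp)

theorem idealI_antitone : Antitone (idealI 𝕜 F) := antitone_nat_of_succ_le idealI_succ_le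

/-- `I_{k+1}(F)` is the smallest subspace that contains `[F, I_k(F)]` and is closed under
anticommutators with elements of `F`. -/
theorem idealI_succ_le_of_anticommutator [CharZero 𝕜] {k : ℕ} {J : Submodule 𝕜 F}
    (hC : comm ⊤ (idealI 𝕜 F k) ≤ J) (hJ : ∀ f, ∀ q ∈ J, f * q + q * f ∈ J) :
    idealI 𝕜 F (k + 1) ≤ J := by
  refine idealI_le fun a l hk => (commProd_le_leftIdeal k a l hk).trans (sup_le hC ?_)
  refine Submodule.map₂_le.2 fun f _ c hc => ?_
  have hc' : c ∈ idealI 𝕜 F k :=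
    comm_le.2 (fun f _ p hp => idealI_succ_le k (commutator_mem_idealI f hp)) hc
  -- `f c` is the mean of the anticommutator and the commutator of `f` and `c`.
  have e : f * c = (2⁻¹ : 𝕜) • ((f * c + c * f) + (f * c - c * f)) := by
    rw [add_add_sub_cancel, ← two_smul 𝕜, smul_smul, inv_mul_cancel₀ two_ne_zero, one_smul]
  change f * c ∈ J
  rw [e]
  exact J.smul_mem _ (J.add_mem (hJ f c (hC hc))
    (hC (commutator_mem_comm Submodule.mem_top hc')))

end Ideals

/-! ### `sl₂`-triples in associative algebras -/

section Triple

variable {𝕜 : Type*} [Field 𝕜] {A : Type*} [Ring A] [Algebra 𝕜 A] {e f h : A}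

theorem mul_pow_of_h_mul_e {c : 𝕜} (he : h * e = e * h + c • e) (k : ℕ) :
    h * e ^ k = e ^ k * h + (c * k : 𝕜) • e ^ k := by
  induction k with
  | zero => simp
  | succ k ih =>
    rw [pow_succ, ← mul_assoc, ih, add_mul, mul_assoc, he, mul_add, mul_smul_comm,
      smul_mul_assoc, mul_assoc]
    push_cast
    module

theorem f_mul_e_pow_succ (he : h * e = e * h + (2 : 𝕜) • e) (hfe : f * e = e * f - h) (k : ℕ) :
    f * e ^ (k + 1) = e ^ (k + 1) * f - (k + 1 : 𝕜) • (e ^ k * h) - ((k + 1) * k : 𝕜) • e ^ k := by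
  induction k with
  | zero => simp [hfe]
  | succ k ih =>
    rw [pow_succ e (k + 1), ← mul_assoc, ih, sub_mul, sub_mul, mul_assoc, hfe, smul_mul_assoc,
      smul_mul_assoc, mul_assoc _ h, he, mul_sub, mul_add, mul_smul_comm]
    simp only [← mul_assoc, ← pow_succ]
    push_cast
    module

theorem anticommutator_h_e_pow [CharZero 𝕜] (he : h * e = e * h + (2 : 𝕜) • e)
    (hfe : f * e = e * f - h) (k : ℕ) :
    h * e ^ (k + 1) + e ^ (k + 1) * h
      = (-2 / (k + 2) : 𝕜) • (f * e ^ (k + 2) - e ^ (k + 2) * f) := by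
  have hk : (k + 2 : 𝕜) ≠ 0 := by exact_mod_cast (by omega : k + 2 ≠ 0)
  rw [mul_pow_of_h_mul_e he, f_mul_e_pow_succ he hfe (k + 1)]
  push_cast
  match_scalars <;> field_simp <;> ring

/-- The component of `f eⁿ + eⁿ f`, `n = k + 1`, outside the adjoint `sl₂`-module generated by
`eⁿ⁺¹`: it is a multiple of `(Δ - (n² - 1)) eⁿ⁻¹`. -/
theorem anticommutator_f_e_pow (he : h * e = e * h + (2 : 𝕜) • e) (hfe : f * e = e * f - h)
    (hf : h * f = f * h - (2 : 𝕜) • f) (k : ℕ) :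
    ((k + 2) * (2 * k + 3) : 𝕜) • (f * e ^ (k + 1) + e ^ (k + 1) * f)
      + (f * (f * e ^ (k + 2) - e ^ (k + 2) * f) - (f * e ^ (k + 2) - e ^ (k + 2) * f) * f)
      = ((k + 1) * (k + 2) : 𝕜) • ((2 * (e * f) + 2 * (f * e) + h ^ 2 -
          algebraMap 𝕜 A ((k + 1) ^ 2 - 1)) * e ^ k) := by
  have h2 : (2 : A) = algebraMap 𝕜 A 2 := (map_ofNat _ 2).symm
  have hk := mul_pow_of_h_mul_e he k
  have hk' : f * e ^ (k + 1) = _ := f_mul_e_pow_succ he hfe k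
  have hk'' : f * e ^ (k + 2) = _ := f_mul_e_pow_succ he hfe (k + 1)
  have hefk : e * (f * e ^ k) = e ^ (k + 1) * f - (k : 𝕜) • (e ^ k * h)
      - ((k - 1) * k : 𝕜) • e ^ k := by
    cases k with
    | zero => simp
    | succ k =>
      rw [f_mul_e_pow_succ he hfe k]
      simp only [mul_sub, mul_smul_comm, ← mul_assoc, ← pow_succ']
      push_cast
      module
  have hR : (2 * (e * f) + 2 * (f * e) + h ^ 2 - algebraMap 𝕜 A ((k + 1) ^ 2 - 1)) * e ^ k
      = (2 : 𝕜) • (e * (f * e ^ k)) + (2 : 𝕜) • (f * e ^ (k + 1)) + h * (h * e ^ k)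
        - ((k + 1) ^ 2 - 1 : 𝕜) • e ^ k := by
    rw [h2, sub_mul, add_mul, add_mul, ← Algebra.smul_def, ← Algebra.smul_def, ← Algebra.smul_def,
      smul_mul_assoc, smul_mul_assoc, mul_assoc e, mul_assoc f, ← pow_succ', pow_two, mul_assoc h]
  have hfek : f * (e ^ (k + 1) * h) = e ^ (k + 1) * (h * f) + (2 : 𝕜) • (e ^ (k + 1) * f)
       - (k + 1 : 𝕜) • (e ^ k * (h * h)) - ((k + 1) * k : 𝕜) • (e ^ k * h) := by
    rw [← mul_assoc, hk', hf]
    simp only [sub_mul, mul_sub, smul_mul_assoc, mul_smul_comm, mul_assoc]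
    module
  have hc : f * e ^ (k + 2) - e ^ (k + 2) * f
      = -(((k + 2 : 𝕜) • (e ^ (k + 1) * h)) + ((k + 2) * (k + 1) : 𝕜) • e ^ (k + 1)) := by
    rw [hk'']; push_cast; module
  rw [hR, hefk, hc]
  simp only [mul_neg, neg_mul, mul_add, add_mul, mul_smul_comm, smul_mul_assoc, hfek, hk', hk,
    mul_assoc, ← mul_assoc h]
  module

theorem commute_e_casimir (he : h * e = e * h + (2 : 𝕜) • e) (hfe : f * e = e * f - h) :
    Commute e (2 * (e * f) + 2 * (f * e) + h ^ 2) := by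
  have h2 : (2 : A) = algebraMap 𝕜 A 2 := (map_ofNat _ 2).symm
  have he' : ∀ x, h * (e * x) = e * (h * x) + (2 : 𝕜) • (e * x) := fun x => by
    rw [← mul_assoc, he, add_mul, smul_mul_assoc, mul_assoc]
  have hfe' : ∀ x, f * (e * x) = e * (f * x) - h * x := fun x => by
    rw [← mul_assoc, hfe, sub_mul, mul_assoc]
  rw [commute_iff_eq, h2, pow_two, ← Algebra.smul_def, ← Algebra.smul_def]
  simp only [mul_add, add_mul, mul_sub, sub_mul, mul_smul_comm, smul_mul_assoc, mul_assoc, he, hfe,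
    he', smul_add, smul_sub]
  module

theorem commute_h_casimir (he : h * e = e * h + (2 : 𝕜) • e)
    (hf : h * f = f * h - (2 : 𝕜) • f) :
    Commute h (2 * (e * f) + 2 * (f * e) + h ^ 2) := by
  have h2 : (2 : A) = algebraMap 𝕜 A 2 := (map_ofNat _ 2).symm
  have he' : ∀ x, h * (e * x) = e * (h * x) + (2 : 𝕜) • (e * x) := fun x => by
    rw [← mul_assoc, he, add_mul, smul_mul_assoc, mul_assoc]
  have hf' : ∀ x, h * (f * x) = f * (h * x) - (2 : 𝕜) • (f * x) := fun x => by
    rw [← mul_assoc, hf, sub_mul, smul_mul_assoc, mul_assoc]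
  rw [commute_iff_eq, h2, pow_two, ← Algebra.smul_def, ← Algebra.smul_def]
  simp only [mul_add, add_mul, mul_sub, mul_smul_comm, smul_mul_assoc, mul_assoc, he, hf,
    he', hf', smul_add, smul_sub]
  module

theorem commute_f_casimir (hfe : f * e = e * f - h) (hf : h * f = f * h - (2 : 𝕜) • f) :
    Commute f (2 * (e * f) + 2 * (f * e) + h ^ 2) := by
  have h2 : (2 : A) = algebraMap 𝕜 A 2 := (map_ofNat _ 2).symm
  have hfe' : ∀ x, f * (e * x) = e * (f * x) - h * x := fun x => by
    rw [← mul_assoc, hfe, sub_mul, mul_assoc]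
  have hf' : ∀ x, h * (f * x) = f * (h * x) - (2 : 𝕜) • (f * x) := fun x => by
    rw [← mul_assoc, hf, sub_mul, smul_mul_assoc, mul_assoc]
  rw [commute_iff_eq, h2, pow_two, ← Algebra.smul_def, ← Algebra.smul_def]
  simp only [mul_add, add_mul, mul_sub, sub_mul, mul_smul_comm, smul_mul_assoc, mul_assoc, hfe, hf,
    hfe', hf', smul_sub]
  module

end Triple

/-! ### The submodules `V_{2i}` and the Casimir element -/

section SlTwo

variable {𝕜 : Type*} [Field 𝕜]

theorem lie_slE_slF : ⁅slE 𝕜, slF 𝕜⁆ = slH 𝕜 := by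
  ext i j
  fin_cases i <;> fin_cases j <;>
    simp [slE, slF, slH, LieSubalgebra.coe_bracket, Ring.lie_def, Matrix.mul_apply,
      Matrix.single]

theorem lie_slH_slE : ⁅slH 𝕜, slE 𝕜⁆ = (2 : 𝕜) • slE 𝕜 := by
  ext i j
  fin_cases i <;> fin_cases j <;>
    simp [slE, slH, LieSubalgebra.coe_bracket, Ring.lie_def, Matrix.mul_apply,
      Matrix.single]
  all_goals norm_num

theorem lie_slH_slF : ⁅slH 𝕜, slF 𝕜⁆ = -((2 : 𝕜) • slF 𝕜) := by
  ext i j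
  fin_cases i <;> fin_cases j <;>
    simp [slF, slH, LieSubalgebra.coe_bracket, Ring.lie_def, Matrix.mul_apply,
      Matrix.single]
  all_goals norm_num

theorem sl2_eq (x : Sl2 𝕜) : ∃ a b c : 𝕜, x = a • slE 𝕜 + b • slF 𝕜 + c • slH 𝕜 := by
  have hx : Matrix.trace x.1 = 0 := x.2
  refine ⟨x.1 0 1, x.1 1 0, x.1 0 0, ?_⟩
  rw [Matrix.trace_fin_two] at hx
  ext i j
  fin_cases i <;> fin_cases j <;>
    simp [slE, slF, slH, Matrix.single]
  exact eq_neg_of_add_eq_zero_right hx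

variable {A : Type*} [Ring A] [Algebra 𝕜 A] (φ : Sl2 𝕜 →ₗ⁅𝕜⁆ A)

theorem map_slH_mul_slE : φ (slH 𝕜) * φ (slE 𝕜)
    = φ (slE 𝕜) * φ (slH 𝕜) + (2 : 𝕜) • φ (slE 𝕜) := by
  have h := φ.map_lie (slH 𝕜) (slE 𝕜)
  rw [lie_slH_slE, map_smul, Ring.lie_def] at h
  rw [h]; abel

theorem map_slH_mul_slF : φ (slH 𝕜) * φ (slF 𝕜)
    = φ (slF 𝕜) * φ (slH 𝕜) - (2 : 𝕜) • φ (slF 𝕜) := by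
  have h := φ.map_lie (slH 𝕜) (slF 𝕜)
  rw [lie_slH_slF, map_neg, map_smul, Ring.lie_def] at h
  rw [sub_eq_add_neg, h]; abel

theorem map_slF_mul_slE : φ (slF 𝕜) * φ (slE 𝕜) = φ (slE 𝕜) * φ (slF 𝕜) - φ (slH 𝕜) := by
  have h := φ.map_lie (slE 𝕜) (slF 𝕜)
  rw [lie_slE_slF, Ring.lie_def] at h
  rw [h]; abel

/-- A linear condition on the elements of `sl₂` need only be checked on the standard basis. -/
theorem forall_sl2_mem {M : Type*} [AddCommGroup M] [Module 𝕜 M] {W : Submodule 𝕜 M}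
    (T : A →ₗ[𝕜] M) (hE : T (φ (slE 𝕜)) ∈ W) (hF : T (φ (slF 𝕜)) ∈ W) (hH : T (φ (slH 𝕜)) ∈ W)
    (x : Sl2 𝕜) : T (φ x) ∈ W := by
  obtain ⟨a, b, c, rfl⟩ := sl2_eq x
  simp only [map_add, map_smul]
  exact W.add_mem (W.add_mem (W.smul_mem _ hE) (W.smul_mem _ hF)) (W.smul_mem _ hH)

theorem commute_casimir (x : Sl2 𝕜) : Commute (φ x) (casimir φ) := by
  have key := forall_sl2_mem φ (W := ⊥) (adL (𝕜 := 𝕜) (casimir φ))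
    (sub_eq_zero.2 (commute_e_casimir (map_slH_mul_slE φ) (map_slF_mul_slE φ)).eq.symm)
    (sub_eq_zero.2 (commute_f_casimir (map_slF_mul_slE φ) (map_slH_mul_slF φ)).eq.symm)
    (sub_eq_zero.2 (commute_h_casimir (map_slH_mul_slE φ) (map_slH_mul_slF φ)).eq.symm) x
  exact (sub_eq_zero.1 ((Submodule.mem_bot 𝕜).1 key)).symm

theorem pow_mem_subV (i : ℕ) : φ (slE 𝕜) ^ i ∈ subV φ i :=
  LieSubmodule.subset_lieSpan (Set.mem_singleton _)

theorem lie_mem_subV {i : ℕ} (x : Sl2 𝕜) {v : A} (hv : v ∈ subV φ i) :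
    φ x * v - v * φ x ∈ subV φ i :=
  LieSubmodule.lie_mem (LieSubmodule.lieSpan 𝕜 φ.range {φ (slE 𝕜) ^ i})
    (x := (⟨φ x, x, rfl⟩ : φ.range)) hv

theorem subV_le {i : ℕ} {W : Submodule 𝕜 A} (hE : φ (slE 𝕜) ^ i ∈ W)
    (hW : ∀ x, ∀ w ∈ W, φ x * w - w * φ x ∈ W) : subV φ i ≤ W := by
  let W' : LieSubmodule 𝕜 φ.range A :=
    { W with
      lie_mem := by
        rintro ⟨_, x, rfl⟩ w hw
        exact hW x w hw }
  have h : LieSubmodule.lieSpan 𝕜 φ.range {φ (slE 𝕜) ^ i} ≤ W' :=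
    LieSubmodule.lieSpan_le.2 (Set.singleton_subset_iff.2 hE)
  exact h

theorem subV_zero : subV φ 0 = 𝕜 ∙ (1 : A) := by
  refine le_antisymm (subV_le φ (by simp [Submodule.mem_span_singleton_self]) ?_) ?_
  · intro x w hw
    obtain ⟨c, rfl⟩ := Submodule.mem_span_singleton.1 hw
    simp
  · rw [Submodule.span_singleton_le_iff_mem]
    simpa using pow_mem_subV φ 0

theorem subV_one [CharZero 𝕜] : subV φ 1 = φ.range.toSubmodule := by
  refine le_antisymm (subV_le φ (by rw [pow_one]; exact ⟨slE 𝕜, rfl⟩) ?_) ?_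
  · rintro x _ ⟨y, rfl⟩
    exact ⟨⁅x, y⁆, by simp [Ring.lie_def]⟩
  · rintro _ ⟨x, rfl⟩
    have hE : φ (slE 𝕜) ∈ subV φ 1 := by simpa using pow_mem_subV φ 1
    have hH : φ (slH 𝕜) ∈ subV φ 1 := by
      have h := (subV φ 1).neg_mem (lie_mem_subV φ (slF 𝕜) hE)
      rwa [map_slF_mul_slE, sub_sub_cancel_left, neg_neg] at h
    have hF : φ (slF 𝕜) ∈ subV φ 1 := by
      have h := lie_mem_subV φ (slF 𝕜) hH
      rw [map_slH_mul_slF, sub_sub_cancel] at h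
      exact (Submodule.smul_mem_iff _ two_ne_zero).1 h
    exact forall_sl2_mem φ LinearMap.id hE hF hH x

/-- The anticommutators of `sl₂` with `V_{2n}`, `n = i + 1`, lie in
`V_{2n+2} + (Δ - (n² - 1)) V_{2n-2}`. By equivariance it is enough to look at the generator `Eⁿ`. -/
theorem anticommutator_mem [CharZero 𝕜] {i : ℕ} (x : Sl2 𝕜) {v : A} (hv : v ∈ subV φ (i + 1)) :
    φ x * v + v * φ x ∈ subV φ (i + 2) ⊔ (subV φ i).map
      (LinearMap.mulLeft 𝕜 (casimir φ - algebraMap 𝕜 A ((i + 1) ^ 2 - 1))) := by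
  set c := casimir φ - algebraMap 𝕜 A ((i + 1) ^ 2 - 1) with hc
  set W := subV φ (i + 2) ⊔ (subV φ i).map (LinearMap.mulLeft 𝕜 c) with hW
  have hcomm : ∀ x, Commute (φ x) c := fun x =>
    (commute_casimir φ x).sub_right (Algebra.commutes _ _).symm
  have hstab : ∀ y, ∀ w ∈ W, φ y * w - w * φ y ∈ W := by
    intro y
    suffices h : W ≤ W.comap (adL (φ y)) from fun w hw => h hw
    refine sup_le (fun w hw => (le_sup_left : _ ≤ W) (lie_mem_subV φ y hw)) ?_
    rintro _ ⟨w, hw, rfl⟩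
    refine (le_sup_right : _ ≤ W) ⟨φ y * w - w * φ y, lie_mem_subV φ y hw, ?_⟩
    simp only [LinearMap.mulLeft_apply, adL_apply]
    rw [← mul_assoc, (hcomm y).eq, mul_sub, mul_assoc, mul_assoc]
  let X : Submodule 𝕜 A :=
    ⨅ y : Sl2 𝕜, W.comap (LinearMap.mulLeft 𝕜 (φ y) + LinearMap.mulRight 𝕜 (φ y))
  have hX : ∀ w, w ∈ X ↔ ∀ y, φ y * w + w * φ y ∈ W := fun w => by
    simp [X, Submodule.mem_iInf]
  suffices h : subV φ (i + 1) ≤ X from (hX v).1 (h hv) x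
  refine subV_le φ ((hX _).2 ?_) fun y w hw => (hX _).2 fun z => ?_
  · have he := map_slH_mul_slE φ
    have hfe := map_slF_mul_slE φ
    have hf := map_slH_mul_slF φ
    have h1 : φ (slF 𝕜) * φ (slE 𝕜) ^ (i + 2) - φ (slE 𝕜) ^ (i + 2) * φ (slF 𝕜)
        ∈ subV φ (i + 2) := lie_mem_subV φ _ (pow_mem_subV φ _)
    refine forall_sl2_mem φ (LinearMap.mulLeft 𝕜 (φ (slE 𝕜) ^ (i + 1)) +
      LinearMap.mulRight 𝕜 (φ (slE 𝕜) ^ (i + 1))) ?_ ?_ ?_ |> fun h y => by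
        simpa [add_comm] using h y
    · simp only [LinearMap.add_apply, LinearMap.mulLeft_apply, LinearMap.mulRight_apply,
        ← pow_succ, ← pow_succ']
      exact (le_sup_left : _ ≤ W) (Submodule.add_mem _ (pow_mem_subV φ _) (pow_mem_subV φ _))
    · have h2 := anticommutator_f_e_pow he hfe hf i
      rw [← eq_sub_iff_add_eq] at h2
      have h3 : ((i + 2) * (2 * i + 3) : 𝕜) ≠ 0 := by
        exact_mod_cast (by positivity : (i + 2) * (2 * i + 3) ≠ 0)
      rw [LinearMap.add_apply, LinearMap.mulLeft_apply, LinearMap.mulRight_apply, add_comm,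
        ← Submodule.smul_mem_iff W h3, h2]
      refine W.sub_mem (W.smul_mem _ ((le_sup_right : _ ≤ W) ⟨_, pow_mem_subV φ i, rfl⟩)) ?_
      exact (le_sup_left : _ ≤ W) (lie_mem_subV φ _ h1)
    · rw [LinearMap.add_apply, LinearMap.mulLeft_apply, LinearMap.mulRight_apply, add_comm,
        anticommutator_h_e_pow he hfe]
      exact (le_sup_left : _ ≤ W) (Submodule.smul_mem _ _ h1)
  · have h1 := hstab y _ ((hX w).1 hw z)
    have h2 := (hX w).1 hw ⁅y, z⁆
    rw [φ.map_lie, Ring.lie_def] at h2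
    have e : φ z * (φ y * w - w * φ y) + (φ y * w - w * φ y) * φ z
        = (φ y * (φ z * w + w * φ z) - (φ z * w + w * φ z) * φ y)
          - ((φ y * φ z - φ z * φ y) * w + w * (φ y * φ z - φ z * φ y)) := by
      noncomm_ring
    rw [e]
    exact W.sub_mem h1 h2

end SlTwo

/-! ### Subspaces of `F ⊗ A` -/

section Tensor

variable {𝕜 : Type*} [Field 𝕜] {F : Type*} [NonUnitalRing F] [Module 𝕜 F]
  {A : Type*} [Ring A] [Algebra 𝕜 A]

theorem tmul_mem_dot {P : Submodule 𝕜 F} {X : Submodule 𝕜 A} {f : F} {x : A} (hf : f ∈ P)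
    (hx : x ∈ X) : f ⊗ₜ[𝕜] x ∈ dot P X :=
  Submodule.apply_mem_map₂ (TensorProduct.mk 𝕜 F A) hf hx

theorem dot_le {P : Submodule 𝕜 F} {X : Submodule 𝕜 A} {W : Submodule 𝕜 (F ⊗[𝕜] A)} :
    dot P X ≤ W ↔ ∀ f ∈ P, ∀ x ∈ X, f ⊗ₜ[𝕜] x ∈ W :=
  Submodule.map₂_le

theorem dot_span_singleton_le {P : Submodule 𝕜 F} {a : A} {W : Submodule 𝕜 (F ⊗[𝕜] A)} :
    dot P (𝕜 ∙ a) ≤ W ↔ ∀ f ∈ P, f ⊗ₜ[𝕜] a ∈ W := by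
  refine ⟨fun h f hf => h (tmul_mem_dot hf (Submodule.mem_span_singleton_self a)),
    fun h => dot_le.2 fun f hf x hx => ?_⟩
  obtain ⟨c, rfl⟩ := Submodule.mem_span_singleton.1 hx
  rw [TensorProduct.tmul_smul]
  exact W.smul_mem c (h f hf)

variable [IsScalarTower 𝕜 F F] [SMulCommClass 𝕜 F F]

/-- A commutator in `F ⊗ A` splits into a part with a commutator in `F` and an anticommutator in
`A`, and one with the two exchanged. -/
theorem two_smul_tmul_commutator (f q : F) (x v : A) :
    (2 : 𝕜) • ((f ⊗ₜ[𝕜] x) * (q ⊗ₜ v) - (q ⊗ₜ v) * (f ⊗ₜ x))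
      = (f * q - q * f) ⊗ₜ (x * v + v * x) + (f * q + q * f) ⊗ₜ (x * v - v * x) := by
  simp only [Algebra.TensorProduct.tmul_mul_tmul, TensorProduct.sub_tmul, TensorProduct.add_tmul,
    TensorProduct.tmul_add, TensorProduct.tmul_sub]
  module

theorem lTensor_adL_mul (a : A) (y z : F ⊗[𝕜] A) :
    (adL (𝕜 := 𝕜) a).lTensor F (y * z)
      = (adL (𝕜 := 𝕜) a).lTensor F y * z + y * (adL (𝕜 := 𝕜) a).lTensor F z := by
  induction y using TensorProduct.induction_on with
  | zero => simp
  | add y₁ y₂ h₁ h₂ => simp only [add_mul, map_add, h₁, h₂]; abel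
  | tmul f x =>
    induction z using TensorProduct.induction_on with
    | zero => simp
    | add z₁ z₂ h₁ h₂ => simp only [mul_add, map_add, h₁, h₂]; abel
    | tmul g y =>
      simp only [Algebra.TensorProduct.tmul_mul_tmul, LinearMap.lTensor_tmul, adL_apply,
        ← TensorProduct.tmul_add]
      congr 1
      noncomm_ring

end Tensor

section SlTwo

variable {𝕜 : Type*} [Field 𝕜] {A : Type*} [Ring A] [Algebra 𝕜 A] (φ : Sl2 𝕜 →ₗ⁅𝕜⁆ A)
  (F : Type*) [NonUnitalRing F] [Module 𝕜 F] [IsScalarTower 𝕜 F F] [SMulCommClass 𝕜 F F]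

/-! ### The explicit form of the current algebra -/

/-- The sum of the subspaces `[F, I_{2j}(F)] · Δʲ⁺¹` and `I_{i+2j}(F) · Δʲ V_{2(i+1)}` over all
`i, j ≥ 0`: the right-hand side of the description of `(sl₂, A)(F)`, with the index `i` shifted by
one to avoid subtraction. -/
def explicitForm : Submodule 𝕜 (F ⊗[𝕜] A) :=
  (⨆ j : ℕ, dot (comm ⊤ (idealI 𝕜 F (2 * j))) (𝕜 ∙ (casimir φ ^ (j + 1)))) ⊔
    ⨆ (i : ℕ) (j : ℕ), dot (idealI 𝕜 F (i + 2 * j))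
      ((subV φ (i + 1)).map (LinearMap.mulLeft 𝕜 (casimir φ ^ j)))

variable {F}

theorem tmul_casimir_pow_mem_explicitForm {j : ℕ} {q : F} (hq : q ∈ comm ⊤ (idealI 𝕜 F (2 * j))) :
    q ⊗ₜ[𝕜] (casimir φ ^ (j + 1)) ∈ explicitForm φ F :=
  (le_sup_left : _ ≤ explicitForm φ F) (Submodule.mem_iSup_of_mem j
    (tmul_mem_dot hq (Submodule.mem_span_singleton_self _)))

theorem tmul_mem_explicitForm {i j : ℕ} {p : F} {v : A} (hp : p ∈ idealI 𝕜 F (i + 2 * j))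
    (hv : v ∈ subV φ (i + 1)) : p ⊗ₜ[𝕜] (casimir φ ^ j * v) ∈ explicitForm φ F :=
  (le_sup_right : _ ≤ explicitForm φ F) (Submodule.mem_iSup_of_mem i (Submodule.mem_iSup_of_mem j
    (tmul_mem_dot hp (Submodule.mem_map_of_mem (f := LinearMap.mulLeft 𝕜 (casimir φ ^ j)) hv))))

theorem explicitForm_le {W : Submodule 𝕜 (F ⊗[𝕜] A)}
    (h₁ : ∀ j, ∀ q ∈ comm ⊤ (idealI 𝕜 F (2 * j)), q ⊗ₜ[𝕜] (casimir φ ^ (j + 1)) ∈ W)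
    (h₂ : ∀ i j, ∀ p ∈ idealI 𝕜 F (i + 2 * j), ∀ v ∈ subV φ (i + 1),
      p ⊗ₜ[𝕜] (casimir φ ^ j * v) ∈ W) : explicitForm φ F ≤ W := by
  refine sup_le (iSup_le fun j => dot_span_singleton_le.2 (h₁ j))
    (iSup_le fun i => iSup_le fun j => dot_le.2 ?_)
  rintro p hp _ ⟨v, hv, rfl⟩
  exact h₂ i j p hp v hv

theorem dot_top_range_le_explicitForm [CharZero 𝕜] :
    dot (⊤ : Submodule 𝕜 F) φ.range.toSubmodule ≤ explicitForm φ F := by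
  refine dot_le.2 fun f _ x hx => ?_
  rw [← subV_one φ] at hx
  simpa using tmul_mem_explicitForm φ (i := 0) (j := 0) (by simp [idealI_zero]) hx

theorem comm_subZ_le_explicitForm :
    comm (dot (⊤ : Submodule 𝕜 F) (𝕜 ∙ casimir φ)) (subZ φ F 1) ≤ explicitForm φ F := by
  refine comm_le.2 fun a ha b hb => ?_
  suffices h : dot (⊤ : Submodule 𝕜 F) (𝕜 ∙ casimir φ) ≤ (explicitForm φ F).comap
      (LinearMap.mulRight 𝕜 b - LinearMap.mulLeft 𝕜 b) from h ha
  refine dot_span_singleton_le.2 fun f _ => ?_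
  suffices h : subZ φ F 1 ≤ (explicitForm φ F).comap (adL (f ⊗ₜ[𝕜] casimir φ)) from h hb
  refine iSup_le fun j => dot_span_singleton_le.2 fun p hp => ?_
  rw [Nat.add_sub_cancel_left] at hp
  rw [Submodule.mem_comap, adL_apply, Algebra.TensorProduct.tmul_mul_tmul,
    Algebra.TensorProduct.tmul_mul_tmul, ← pow_succ', ← pow_succ, ← TensorProduct.sub_tmul]
  exact tmul_casimir_pow_mem_explicitForm φ (commutator_mem_comm Submodule.mem_top hp)

theorem rdot_le_explicitForm (i : ℕ) :
    rdot (subZ φ F (i + 1)) (subV φ (i + 1)) ≤ explicitForm φ F := by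
  refine Submodule.span_le.2 ?_
  rintro _ ⟨w, hw, v, hv, rfl⟩
  suffices h : subZ φ F (i + 1) ≤ (explicitForm φ F).comap
      ((LinearMap.mulRight 𝕜 v).lTensor F) from h hw
  refine iSup_le fun j => dot_span_singleton_le.2 fun p hp => ?_
  exact tmul_mem_explicitForm φ (by rwa [show i + 1 + 2 * j - 1 = i + 2 * j by omega] at hp) hv

theorem eq_explicitForm [CharZero 𝕜] :
    dot (⊤ : Submodule 𝕜 F) φ.range.toSubmodule
        ⊔ comm (dot (⊤ : Submodule 𝕜 F) (𝕜 ∙ casimir φ)) (subZ φ F 1)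
        ⊔ ⨆ (i : ℕ) (_ : 1 ≤ i), rdot (subZ φ F i) (subV φ i) = explicitForm φ F := by
  refine le_antisymm (sup_le (sup_le (dot_top_range_le_explicitForm φ)
    (comm_subZ_le_explicitForm φ)) (iSup_le fun i => iSup_le fun hi => ?_))
    (explicitForm_le φ (fun j q hq => ?_) fun i j p hp v hv => ?_)
  · obtain ⟨i, rfl⟩ := Nat.exists_eq_add_of_le' hi
    exact rdot_le_explicitForm φ i
  · refine Submodule.mem_sup_left (Submodule.mem_sup_right ?_)
    suffices h : comm ⊤ (idealI 𝕜 F (2 * j)) ≤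
        (comm (dot (⊤ : Submodule 𝕜 F) (𝕜 ∙ casimir φ)) (subZ φ F 1)).comap
          ((TensorProduct.mk 𝕜 F A).flip (casimir φ ^ (j + 1))) from h hq
    refine comm_le.2 fun f _ p hp => ?_
    rw [Submodule.mem_comap, LinearMap.flip_apply, TensorProduct.mk_apply, TensorProduct.sub_tmul]
    nth_rw 1 [pow_succ']
    rw [pow_succ, ← Algebra.TensorProduct.tmul_mul_tmul, ← Algebra.TensorProduct.tmul_mul_tmul]
    refine commutator_mem_comm
      (tmul_mem_dot Submodule.mem_top (Submodule.mem_span_singleton_self _))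
      (Submodule.mem_iSup_of_mem j (tmul_mem_dot ?_ (Submodule.mem_span_singleton_self _)))
    rwa [Nat.add_sub_cancel_left]
  · refine Submodule.mem_sup_right (Submodule.mem_iSup_of_mem (i + 1) (Submodule.mem_iSup_of_mem
      (Nat.le_add_left 1 i) (Submodule.subset_span ⟨p ⊗ₜ (casimir φ ^ j), ?_, v, hv, rfl⟩)))
    refine Submodule.mem_iSup_of_mem j
      (tmul_mem_dot ?_ (Submodule.mem_span_singleton_self _))
    rwa [show i + 1 + 2 * j - 1 = i + 2 * j by omega]

/-! ### The current algebra is contained in the explicit form -/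

theorem explicitForm_stable [CharZero 𝕜] (f : F) (x : Sl2 𝕜) {w : F ⊗[𝕜] A}
    (hw : w ∈ explicitForm φ F) :
    (f ⊗ₜ[𝕜] φ x) * w - w * (f ⊗ₜ φ x) ∈ explicitForm φ F := by
  set R := explicitForm φ F
  have hΔ : ∀ j, Commute (φ x) (casimir φ ^ j) := fun j => (commute_casimir φ x).pow_right j
  suffices h : explicitForm φ F ≤ R.comap (adL (f ⊗ₜ[𝕜] φ x)) from h hw
  refine explicitForm_le φ (fun j q hq => ?_) fun i j p hp v hv => ?_
  · rw [Submodule.mem_comap, adL_apply, Algebra.TensorProduct.tmul_mul_tmul,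
      Algebra.TensorProduct.tmul_mul_tmul, (hΔ (j + 1)).eq, ← TensorProduct.sub_tmul]
    have hq' : q ∈ idealI 𝕜 F (2 * j + 1) :=
      comm_le.2 (fun g _ p hp => commutator_mem_idealI g hp) hq
    refine tmul_mem_explicitForm φ (i := 0) ?_ (by rw [subV_one]; exact ⟨x, rfl⟩)
    exact (by ring : 2 * j + 1 + 1 = 0 + 2 * (j + 1)) ▸ commutator_mem_idealI f hq'
  · rw [Submodule.mem_comap, adL_apply, ← Submodule.smul_mem_iff R (two_ne_zero (α := 𝕜)),
      two_smul_tmul_commutator]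
    have h₁ : φ x * (casimir φ ^ j * v) + casimir φ ^ j * v * φ x
        = casimir φ ^ j * (φ x * v + v * φ x) := by
      rw [← mul_assoc, (hΔ j).eq, mul_add, mul_assoc, mul_assoc]
    have h₂ : φ x * (casimir φ ^ j * v) - casimir φ ^ j * v * φ x
        = casimir φ ^ j * (φ x * v - v * φ x) := by
      rw [← mul_assoc, (hΔ j).eq, mul_sub, mul_assoc, mul_assoc]
    rw [h₁, h₂]
    refine R.add_mem ?_ (tmul_mem_explicitForm φ
      (Submodule.add_mem _ (mul_mem_idealI f hp) (idealI_mul_mem hp f)) (lie_mem_subV φ x hv))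
    have hc : f * p - p * f ∈ idealI 𝕜 F (i + 2 * j + 1) := commutator_mem_idealI f hp
    suffices h : subV φ (i + 2) ⊔ (subV φ i).map
        (LinearMap.mulLeft 𝕜 (casimir φ - algebraMap 𝕜 A ((i + 1) ^ 2 - 1))) ≤
        R.comap (TensorProduct.mk 𝕜 F A (f * p - p * f) ∘ₗ LinearMap.mulLeft 𝕜 (casimir φ ^ j))
      from h (anticommutator_mem φ x hv)
    refine sup_le (fun u hu => ?_) ?_
    · exact tmul_mem_explicitForm φ (i := i + 1)
        ((by ring : i + 2 * j + 1 = i + 1 + 2 * j) ▸ hc) hu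
    rintro _ ⟨u, hu, rfl⟩
    change (f * p - p * f) ⊗ₜ[𝕜] (casimir φ ^ j *
      ((casimir φ - algebraMap 𝕜 A ((i + 1) ^ 2 - 1)) * u)) ∈ R
    cases i with
    | zero =>
      -- Here the scalar `(i + 1)² - 1` vanishes, and `V₀` is spanned by `1`.
      rw [subV_zero] at hu
      obtain ⟨c, rfl⟩ := Submodule.mem_span_singleton.1 hu
      have e : casimir φ ^ j * ((casimir φ - algebraMap 𝕜 A (((0 : ℕ) + 1) ^ 2 - 1)) * c • 1)
          = c • casimir φ ^ (j + 1) := by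
        simp [pow_succ]
      rw [e, TensorProduct.tmul_smul]
      rw [zero_add] at hp
      exact R.smul_mem c
        (tmul_casimir_pow_mem_explicitForm φ (commutator_mem_comm Submodule.mem_top hp))
    | succ i =>
      rw [sub_mul, mul_sub, ← mul_assoc, ← pow_succ, ← Algebra.smul_def, mul_smul_comm,
        TensorProduct.tmul_sub, TensorProduct.tmul_smul]
      refine R.sub_mem (tmul_mem_explicitForm φ ?_ hu)
        (R.smul_mem _ (tmul_mem_explicitForm φ ?_ hu))
      · exact (by ring : i + 1 + 2 * j + 1 = i + 2 * (j + 1)) ▸ hc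
      · exact idealI_antitone (by omega) hc

theorem current_le_explicitForm [CharZero 𝕜] : current φ.range F ≤ explicitForm φ F := by
  refine lieGenerated_le_of_stable (dot_top_range_le_explicitForm φ) fun s hs p hp => ?_
  suffices h : dot (⊤ : Submodule 𝕜 F) φ.range.toSubmodule ≤ (explicitForm φ F).comap
      (LinearMap.mulRight 𝕜 p - LinearMap.mulLeft 𝕜 p) from h hs
  refine dot_le.2 ?_
  rintro f - _ ⟨x, rfl⟩
  exact explicitForm_stable φ f x hp

/-! ### The explicit form is contained in the current algebra -/

theorem tmul_mem_current (f : F) (x : Sl2 𝕜) : f ⊗ₜ[𝕜] φ x ∈ current φ.range F :=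
  subset_lieGenerated _ (tmul_mem_dot Submodule.mem_top ⟨x, rfl⟩)

/-- `(sl₂, A)(F)` is stable under the adjoint action of `1 ⊗ sl₂`, even if `F` has no unit. -/
theorem lTensor_adL_mem_current (x : Sl2 𝕜) {w : F ⊗[𝕜] A} (hw : w ∈ current φ.range F) :
    (adL (𝕜 := 𝕜) (φ x)).lTensor F w ∈ current φ.range F := by
  refine derivation_mem_lieGenerated _ (lTensor_adL_mul _) (fun s hs => ?_) hw
  suffices h : dot (⊤ : Submodule 𝕜 F) φ.range.toSubmodule ≤ (current φ.range F).comap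
      ((adL (𝕜 := 𝕜) (φ x)).lTensor F) from h hs
  refine dot_le.2 ?_
  rintro f - _ ⟨y, rfl⟩
  have h := tmul_mem_current φ f ⁅x, y⁆
  rwa [φ.map_lie, Ring.lie_def] at h

variable (F) in
/-- The coefficient space of `Δʲ Eⁱ⁺¹` in `(sl₂, A)(F)`: all `q ∈ F` such that `q ⊗ Δʲ Eⁱ⁺¹` lies in
`(sl₂, A)(F)`. -/
def coeffSpace (i j : ℕ) : Submodule 𝕜 F :=
  (current φ.range F).comap
    ((TensorProduct.mk 𝕜 F A).flip (casimir φ ^ j * φ (slE 𝕜) ^ (i + 1)))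

theorem tmul_mem_of_mem_coeffSpace {i j : ℕ} {q : F} (hq : q ∈ coeffSpace φ F i j) {v : A}
    (hv : v ∈ subV φ (i + 1)) : q ⊗ₜ[𝕜] (casimir φ ^ j * v) ∈ current φ.range F := by
  suffices h : subV φ (i + 1) ≤ (current φ.range F).comap
      (TensorProduct.mk 𝕜 F A q ∘ₗ LinearMap.mulLeft 𝕜 (casimir φ ^ j)) from h hv
  refine subV_le φ hq fun x w hw => ?_
  have h := lTensor_adL_mem_current φ x hw
  have e : φ x * (casimir φ ^ j * w) - casimir φ ^ j * w * φ x
      = casimir φ ^ j * (φ x * w - w * φ x) := by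
    rw [← mul_assoc, ((commute_casimir φ x).pow_right j).eq, mul_sub, mul_assoc, mul_assoc]
  simp only [LinearMap.comp_apply, LinearMap.mulLeft_apply, TensorProduct.mk_apply,
    LinearMap.lTensor_tmul, adL_apply, e] at h
  exact h

/-- What a bracket with `f ⊗ x` says about an element `q ⊗ Δʲ Eⁱ⁺¹` of `(sl₂, A)(F)`. -/
theorem bracket_mem_current {i j : ℕ} {q : F} (hq : q ∈ coeffSpace φ F i j) (f : F) (x : Sl2 𝕜) :
    (f * q - q * f) ⊗ₜ[𝕜] (casimir φ ^ j *
        (φ x * φ (slE 𝕜) ^ (i + 1) + φ (slE 𝕜) ^ (i + 1) * φ x))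
      + (f * q + q * f) ⊗ₜ[𝕜] (casimir φ ^ j *
        (φ x * φ (slE 𝕜) ^ (i + 1) - φ (slE 𝕜) ^ (i + 1) * φ x)) ∈ current φ.range F := by
  have h := Submodule.smul_mem _ (2 : 𝕜)
    (commutator_mem_lieGenerated (tmul_mem_current φ f x) (Submodule.mem_comap.1 hq))
  rw [LinearMap.flip_apply, TensorProduct.mk_apply, two_smul_tmul_commutator, ← mul_assoc,
    ((commute_casimir φ x).pow_right j).eq, mul_assoc, mul_assoc, ← mul_add, ← mul_sub] at h
  exact h

theorem commutator_mem_coeffSpace_succ [CharZero 𝕜] {i j : ℕ} {q : F}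
    (hq : q ∈ coeffSpace φ F i j) (f : F) : f * q - q * f ∈ coeffSpace φ F (i + 1) j := by
  have h := bracket_mem_current φ hq f (slE 𝕜)
  rw [← pow_succ, ← pow_succ', sub_self, mul_zero, TensorProduct.tmul_zero, add_zero, ← two_smul 𝕜,
    mul_smul_comm, TensorProduct.tmul_smul, Submodule.smul_mem_iff _ two_ne_zero] at h
  exact h

theorem anticommutator_mem_coeffSpace [CharZero 𝕜] {i j : ℕ} {q : F}
    (hq : q ∈ coeffSpace φ F i j) (f : F) : f * q + q * f ∈ coeffSpace φ F i j := by
  have h := bracket_mem_current φ hq f (slH 𝕜)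
  have hV : φ (slF 𝕜) * φ (slE 𝕜) ^ (i + 2) - φ (slE 𝕜) ^ (i + 2) * φ (slF 𝕜) ∈ subV φ (i + 2) :=
    lie_mem_subV φ _ (pow_mem_subV φ _)
  have h' := tmul_mem_of_mem_coeffSpace φ (commutator_mem_coeffSpace_succ φ hq f)
    (Submodule.smul_mem _ (-2 / (i + 2) : 𝕜) hV)
  rw [← anticommutator_h_e_pow (map_slH_mul_slE φ) (map_slF_mul_slE φ)] at h'
  have h'' := (Submodule.add_mem_iff_right _ h').1 h
  have hi : (2 * (i + 1 : ℕ) : 𝕜) ≠ 0 := by exact_mod_cast (by omega : 2 * (i + 1) ≠ 0)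
  rw [mul_pow_of_h_mul_e (map_slH_mul_slE φ), add_sub_cancel_left, mul_smul_comm,
    TensorProduct.tmul_smul, Submodule.smul_mem_iff _ hi] at h''
  exact h''

/-- The bracket with `f ⊗ x`, for `x` the lowering element of `sl₂`, lowers the power of `E`
and, up to a scalar correction, raises the power of the Casimir element. -/
theorem commutator_tmul_casimir_sub_mem_current [CharZero 𝕜] {i j : ℕ} {q : F}
    (hq : q ∈ coeffSpace φ F i j) (f : F) :
    (f * q - q * f) ⊗ₜ[𝕜] (casimir φ ^ j *
      ((casimir φ - algebraMap 𝕜 A ((i + 1) ^ 2 - 1)) * φ (slE 𝕜) ^ i)) ∈ current φ.range F := by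
  set L := current φ.range F
  have hV := lie_mem_subV φ (slF 𝕜) (pow_mem_subV φ (i + 2))
  have h₁ := (Submodule.add_mem_iff_left L (tmul_mem_of_mem_coeffSpace φ
    (anticommutator_mem_coeffSpace φ hq f)
    (lie_mem_subV φ (slF 𝕜) (pow_mem_subV φ (i + 1))))).1 (bracket_mem_current φ hq f (slF 𝕜))
  have h₂ := tmul_mem_of_mem_coeffSpace φ (commutator_mem_coeffSpace_succ φ hq f)
    (lie_mem_subV φ (slF 𝕜) hV)
  have h₃ := L.add_mem (L.smul_mem ((i + 2) * (2 * i + 3) : 𝕜) h₁) h₂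
  rw [← TensorProduct.tmul_smul, ← mul_smul_comm, ← TensorProduct.tmul_add, ← mul_add,
    anticommutator_f_e_pow (map_slH_mul_slE φ) (map_slF_mul_slE φ) (map_slH_mul_slF φ),
    mul_smul_comm, TensorProduct.tmul_smul, Submodule.smul_mem_iff L
      (by exact_mod_cast (by positivity : (i + 1) * (i + 2) ≠ 0))] at h₃
  exact h₃

theorem idealI_le_coeffSpace [CharZero 𝕜] (i j : ℕ) :
    idealI 𝕜 F (i + 2 * j) ≤ coeffSpace φ F i j := by
  induction j generalizing i with
  | zero =>
    induction i with
    | zero =>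
      intro f _
      have h := tmul_mem_current φ f (slE 𝕜)
      simpa [coeffSpace] using h
    | succ i ih =>
      refine idealI_succ_le_of_anticommutator (comm_le.2 fun f _ p hp => ?_)
        fun f q hq => anticommutator_mem_coeffSpace φ hq f
      exact commutator_mem_coeffSpace_succ φ (ih hp) f
  | succ j ih =>
    rw [show i + 2 * (j + 1) = (i + 1 + 2 * j) + 1 by ring]
    refine idealI_succ_le_of_anticommutator (comm_le.2 fun f _ p hp => ?_)
      fun f q hq => anticommutator_mem_coeffSpace φ hq f
    have h := commutator_tmul_casimir_sub_mem_current φ (ih (i + 1) hp) f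
    have h' : f * p - p * f ∈ coeffSpace φ F i j :=
      ih i (idealI_antitone (by omega) (commutator_mem_idealI f hp))
    rw [sub_mul, mul_sub, ← mul_assoc, ← pow_succ, ← Algebra.smul_def, mul_smul_comm,
      TensorProduct.tmul_sub, TensorProduct.tmul_smul] at h
    exact (Submodule.sub_mem_iff_left _ (Submodule.smul_mem _ _ (Submodule.mem_comap.1 h'))).1 h

theorem explicitForm_le_current [CharZero 𝕜] : explicitForm φ F ≤ current φ.range F := by
  refine explicitForm_le φ (fun j q hq => ?_) fun i j p hp v hv =>
    tmul_mem_of_mem_coeffSpace φ (idealI_le_coeffSpace φ i j hp) hv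
  suffices h : comm ⊤ (idealI 𝕜 F (2 * j)) ≤ (current φ.range F).comap
      ((TensorProduct.mk 𝕜 F A).flip (casimir φ ^ (j + 1))) from h hq
  refine comm_le.2 fun f _ p hp => ?_
  have h := commutator_tmul_casimir_sub_mem_current φ
    (idealI_le_coeffSpace φ 0 j ((zero_add (2 * j)).symm ▸ hp)) f
  simpa [pow_succ, TensorProduct.sub_tmul] using h

theorem current_eq_explicitForm [CharZero 𝕜] : current φ.range F = explicitForm φ F :=
  le_antisymm (current_le_explicitForm φ) (explicitForm_le_current φ)

end SlTwo

/-! ### Simple `sl₂`-modules -/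

section Simple

variable {𝕜 : Type*} [Field 𝕜] [CharZero 𝕜] {V : Type*} [AddCommGroup V] [Module 𝕜 V]

/-- An eigenvector `e` of `ad h` with nonzero eigenvalue is nilpotent: its nonzero powers are
eigenvectors of `ad h` with distinct eigenvalues, hence finitely many. -/
theorem pow_finrank_eq_zero_of_mul_eq [FiniteDimensional 𝕜 V] {e h : Module.End 𝕜 V} {c : 𝕜}
    (hc : c ≠ 0) (he : h * e = e * h + c • e) : e ^ Module.finrank 𝕜 V = 0 := by
  obtain ⟨k, hk⟩ : ∃ k, e ^ k = 0 := by
    by_contra! hne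
    have hev : ∀ k : ℕ, Module.End.HasEigenvalue (adL (𝕜 := 𝕜) h) (c * k) := fun k => by
      refine Module.End.hasEigenvalue_of_hasEigenvector (x := e ^ k)
        ⟨Module.End.mem_eigenspace_iff.2 ?_, hne k⟩
      rw [adL_apply, mul_pow_of_h_mul_e he, add_sub_cancel_left]
    have hinj : Function.Injective fun k : ℕ => c * (k : 𝕜) := fun a b hab => by
      simpa [hc] using hab
    exact Set.infinite_range_of_injective hinj
      ((Module.End.finite_hasEigenvalue (adL (𝕜 := 𝕜) h)).subset
        (Set.range_subset_iff.2 hev))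
  refine LinearMap.ker_eq_top.1 (top_le_iff.1 ?_)
  have h := Module.End.ker_pow_le_ker_pow_finrank e k
  rwa [hk, LinearMap.ker_zero] at h

/-- If `f` is nilpotent on a nonzero vector of `ker e`, then `ker e` contains an eigenvector of `h`
with eigenvalue in `ℕ`. This replaces the existence of eigenvalues over an algebraically closed
field. -/
theorem exists_primitive_of_pow_apply_eq_zero {e f h : Module.End 𝕜 V}
    (he : h * e = e * h + (2 : 𝕜) • e) (hfe : f * e = e * f - h)
    (hf : h * f = f * h - (2 : 𝕜) • f) (k : ℕ) {u : V} (hu : u ≠ 0) (heu : e u = 0)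
    (hfu : (f ^ k) u = 0) : ∃ (s : ℕ) (w : V), w ≠ 0 ∧ e w = 0 ∧ h w = (s : 𝕜) • w := by
  induction k generalizing u with
  | zero => exact absurd hfu hu
  | succ k ih =>
    by_cases h0 : h u - (k : 𝕜) • u = 0
    · exact ⟨k, u, hu, heu, sub_eq_zero.1 h0⟩
    · refine ih h0 ?_ ?_
      · have h1 := LinearMap.congr_fun he u
        simp only [Module.End.mul_apply, LinearMap.add_apply, LinearMap.smul_apply, heu, map_zero,
          smul_zero, add_zero] at h1
        rw [map_sub, map_smul, heu, ← h1, smul_zero, sub_zero]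
      · -- `e f^(k+1) u = (k+1) f^k (h - k) u`, by the commutation rule for the triple `(f, e, -h)`.
        have h1 := LinearMap.congr_fun (f_mul_e_pow_succ (e := f) (f := e) (h := -h) (𝕜 := 𝕜)
          (by rw [neg_mul, mul_neg, hf]; abel) (by rw [hfe]; abel) k) u
        simp only [Module.End.mul_apply, LinearMap.sub_apply, LinearMap.smul_apply, heu, hfu,
          map_zero, LinearMap.neg_apply, map_neg] at h1
        have h2 : (k + 1 : 𝕜) • (f ^ k) (h u - (k : 𝕜) • u) = 0 := by
          rw [map_sub, map_smul, h1]
          module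
        exact (smul_eq_zero.1 h2).resolve_left (by exact_mod_cast k.succ_ne_zero)

variable (𝕜) in
theorem isSl2Triple : IsSl2Triple (slH 𝕜) (slE 𝕜) (slF 𝕜) where
  h_ne_zero h := by
    have h1 := congr_fun (congr_fun (congrArg Subtype.val h) 0) 0
    simp [slH] at h1
  lie_e_f := lie_slE_slF
  lie_h_e_nsmul := by rw [lie_slH_slE, ofNat_smul_eq_nsmul]
  lie_h_f_nsmul := by rw [lie_slH_slF, ofNat_smul_eq_nsmul]

variable [LieRingModule (Sl2 𝕜) V] [LieModule 𝕜 (Sl2 𝕜) V]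

/-- The Casimir element acts on a simple `sl₂`-module of dimension greater than one by a nonzero
scalar: it is `s² + 2s` if `s` is the eigenvalue of `H` on a vector killed by `E`. -/
theorem exists_casimir_eq_smul_one [FiniteDimensional 𝕜 V]
    (hV : LieModule.IsIrreducible 𝕜 (Sl2 𝕜) V) (hdim : 1 < Module.finrank 𝕜 V) :
    ∃ c : 𝕜, c ≠ 0 ∧ casimir (LieModule.toEnd 𝕜 (Sl2 𝕜) V) = c • 1 := by
  set φ := LieModule.toEnd 𝕜 (Sl2 𝕜) V with hφ
  have he := map_slH_mul_slE φ
  have hfe := map_slF_mul_slE φ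
  have hf := map_slH_mul_slF φ
  have hEn : φ (slE 𝕜) ^ Module.finrank 𝕜 V = 0 :=
    pow_finrank_eq_zero_of_mul_eq two_ne_zero he
  have hFn : φ (slF 𝕜) ^ Module.finrank 𝕜 V = 0 :=
    pow_finrank_eq_zero_of_mul_eq (c := -2) (neg_ne_zero.2 two_ne_zero)
      (by rw [hf, neg_smul, sub_eq_add_neg])
  have : Nontrivial V := Module.nontrivial_of_finrank_pos (R := 𝕜) (by omega)
  obtain ⟨u, heu, hu⟩ : ∃ u, φ (slE 𝕜) u = 0 ∧ u ≠ 0 := by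
    by_contra! hne
    have hinj : Function.Injective (φ (slE 𝕜)) :=
      (injective_iff_map_eq_zero _).2 hne
    obtain ⟨v, hv⟩ := exists_ne (0 : V)
    have h := hinj.iterate (Module.finrank 𝕜 V)
    rw [← Module.End.coe_pow, hEn] at h
    exact hv (h (by simp))
  obtain ⟨s, w, hw, hEw, hHw⟩ := exists_primitive_of_pow_apply_eq_zero he hfe hf _ hu heu
    (by rw [hFn, LinearMap.zero_apply])
  have hs : s ≠ 0 := by
    rintro rfl
    have hprim : (isSl2Triple 𝕜).HasPrimitiveVectorWith w (0 : 𝕜) :=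
      ⟨hw, by simpa [hφ] using hHw, by simpa [hφ] using hEw⟩
    have hFw' : ⁅slF 𝕜, w⁆ = 0 := by
      simpa using hprim.pow_toEnd_f_eq_zero_of_eq_nat (n := 0) (by simp)
    have hFw : φ (slF 𝕜) w = 0 := hFw'
    have hx : ∀ x, φ x w = 0 := fun x => by
      have h := forall_sl2_mem φ (W := ⊥) (LinearMap.applyₗ w)
        (by simpa using hEw) (by simpa using hFw) (by simpa using hHw) x
      simpa using h
    let N : LieSubmodule 𝕜 (Sl2 𝕜) V :=
      { 𝕜 ∙ w with
        lie_mem := by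
          intro x v hv
          obtain ⟨a, rfl⟩ := Submodule.mem_span_singleton.1 hv
          have h : ⁅x, w⁆ = 0 := hx x
          simp [h] }
    have hwN : w ∈ N := Submodule.mem_span_singleton_self w
    have hN : N = ⊤ := (hV.eq_bot_or_eq_top N).resolve_left fun h => by
      rw [h, LieSubmodule.mem_bot] at hwN
      exact hw hwN
    have hN' : (𝕜 ∙ w) = ⊤ := congrArg LieSubmodule.toSubmodule hN
    have h1 := finrank_span_singleton (K := 𝕜) hw
    rw [hN', finrank_top] at h1
    omega
  have hΔw : casimir φ w = ((s : 𝕜) ^ 2 + 2 * s) • w := by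
    have h1 : φ (slE 𝕜) (φ (slF 𝕜) w) = (s : 𝕜) • w := by
      have h2 := LinearMap.congr_fun hfe w
      simp only [Module.End.mul_apply, LinearMap.sub_apply, hEw, map_zero, hHw] at h2
      exact (sub_eq_zero.1 h2.symm)
    have h2 : (2 : Module.End 𝕜 V) = algebraMap 𝕜 _ 2 := (map_ofNat _ 2).symm
    rw [casimir, h2, ← Algebra.smul_def, ← Algebra.smul_def, pow_two]
    simp only [LinearMap.add_apply, LinearMap.smul_apply, Module.End.mul_apply, h1, hEw, hHw,
      map_zero, map_smul]
    module
  refine ⟨(s : 𝕜) ^ 2 + 2 * s, by exact_mod_cast (by positivity : s ^ 2 + 2 * s ≠ 0), ?_⟩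
  -- The eigenspace of the Casimir element is a submodule.
  let N : LieSubmodule 𝕜 (Sl2 𝕜) V :=
    { Module.End.eigenspace (casimir φ) ((s : 𝕜) ^ 2 + 2 * s) with
      lie_mem := by
        intro x v hv
        have hv' : casimir φ v = _ := Module.End.mem_eigenspace_iff.1 hv
        have h := LinearMap.congr_fun (commute_casimir φ x).eq v
        simp only [Module.End.mul_apply, hv', map_smul] at h
        exact Module.End.mem_eigenspace_iff.2 h.symm }
  have hwN : w ∈ N := Module.End.mem_eigenspace_iff.2 hΔw
  have hN : N = ⊤ := (hV.eq_bot_or_eq_top N).resolve_left fun h => by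
    rw [h, LieSubmodule.mem_bot] at hwN
    exact hw hwN
  ext v
  have hv : v ∈ N := hN ▸ LieSubmodule.mem_top v
  exact Module.End.mem_eigenspace_iff.1 hv

/-- On a simple module of dimension `m + 1 ≥ 2` the powers of the Casimir element in the explicit
form are nonzero scalars, and `V_{2k}` vanishes for `k > m`. -/
theorem explicitForm_toEnd (F : Type*) [NonUnitalRing F] [Module 𝕜 F] [IsScalarTower 𝕜 F F]
    [SMulCommClass 𝕜 F F] {m : ℕ} (hm : 1 ≤ m) (hV : LieModule.IsIrreducible 𝕜 (Sl2 𝕜) V)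
    (hdim : Module.finrank 𝕜 V = m + 1) :
    explicitForm (LieModule.toEnd 𝕜 (Sl2 𝕜) V) F =
      dot (comm (⊤ : Submodule 𝕜 F) ⊤) (𝕜 ∙ (1 : Module.End 𝕜 V))
        ⊔ ⨆ (k : ℕ) (_ : 1 ≤ k) (_ : k ≤ m),
            dot (idealI 𝕜 F (k - 1)) (subV (LieModule.toEnd 𝕜 (Sl2 𝕜) V) k) := by
  have : FiniteDimensional 𝕜 V := Module.finite_of_finrank_pos (by omega)
  obtain ⟨c, hc, hΔ⟩ := exists_casimir_eq_smul_one hV (by omega)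
  set φ := LieModule.toEnd 𝕜 (Sl2 𝕜) V
  have hΔp : ∀ j, casimir φ ^ j = c ^ j • 1 := fun j => by rw [hΔ, smul_pow, one_pow]
  refine le_antisymm (explicitForm_le φ (fun j q hq => ?_) fun i j p hp v hv => ?_)
    (sup_le (dot_span_singleton_le.2 fun q hq => ?_) (iSup_le fun k => iSup_le fun hk =>
      iSup_le fun _ => dot_le.2 fun p hp v hv => ?_))
  · rw [hΔp, TensorProduct.tmul_smul]
    exact Submodule.smul_mem _ _ (Submodule.mem_sup_left
      (tmul_mem_dot (comm_mono le_rfl le_top hq) (Submodule.mem_span_singleton_self _)))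
  · rw [hΔp, smul_mul_assoc, one_mul, TensorProduct.tmul_smul]
    refine Submodule.smul_mem _ _ ?_
    rcases le_or_gt (i + 1) m with him | him
    · exact Submodule.mem_sup_right (Submodule.mem_iSup_of_mem (i + 1)
        (Submodule.mem_iSup_of_mem (Nat.le_add_left 1 i) (Submodule.mem_iSup_of_mem him
          (tmul_mem_dot (idealI_antitone (by omega) hp) hv))))
    · have hE : φ (slE 𝕜) ^ (i + 1) = 0 := by
        refine pow_eq_zero_of_le (m := Module.finrank 𝕜 V) (by omega) ?_
        exact pow_finrank_eq_zero_of_mul_eq two_ne_zero (map_slH_mul_slE φ)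
      have hv0 : v = 0 := (Submodule.mem_bot 𝕜).1
        (subV_le φ (W := ⊥) (by simp [hE]) (by simp) hv)
      rw [hv0, TensorProduct.tmul_zero]
      exact Submodule.zero_mem _
  · have h := tmul_casimir_pow_mem_explicitForm φ (j := 0) (q := q)
      (by rwa [mul_zero, idealI_zero])
    rwa [hΔp, TensorProduct.tmul_smul, Submodule.smul_mem_iff _ (pow_ne_zero _ hc)] at h
  · obtain ⟨i, rfl⟩ := Nat.exists_eq_add_of_le' hk
    simpa using tmul_mem_explicitForm φ (i := i) (j := 0) hp hv

end Simple

end NCurrent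

theorem mainTheorem3 (𝕜 : Type*) [Field 𝕜] [CharZero 𝕜]
    (F : Type*) [NonUnitalRing F] [Module 𝕜 F] [IsScalarTower 𝕜 F F] [SMulCommClass 𝕜 F F] :
    (∀ (A : Type*) [Ring A] [Algebra 𝕜 A] (φ : NCurrent.Sl2 𝕜 →ₗ⁅𝕜⁆ A),
      Function.Injective φ →
        NCurrent.current φ.range F =
          NCurrent.dot (⊤ : Submodule 𝕜 F) φ.range.toSubmodule
            ⊔ NCurrent.comm (NCurrent.dot (⊤ : Submodule 𝕜 F) (𝕜 ∙ NCurrent.casimir φ))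
                (NCurrent.subZ φ F 1)
            ⊔ ⨆ (i : ℕ) (_ : 1 ≤ i), NCurrent.rdot (NCurrent.subZ φ F i) (NCurrent.subV φ i)) ∧
    (∀ (m : ℕ) (V : Type*) [AddCommGroup V] [Module 𝕜 V]
      [LieRingModule (NCurrent.Sl2 𝕜) V] [LieModule 𝕜 (NCurrent.Sl2 𝕜) V],
      1 ≤ m → LieModule.IsIrreducible 𝕜 (NCurrent.Sl2 𝕜) V → Module.finrank 𝕜 V = m + 1 →
        NCurrent.current (LieModule.toEnd 𝕜 (NCurrent.Sl2 𝕜) V).range F =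
          NCurrent.dot (NCurrent.comm (⊤ : Submodule 𝕜 F) ⊤) (𝕜 ∙ (1 : Module.End 𝕜 V))
            ⊔ ⨆ (k : ℕ) (_ : 1 ≤ k) (_ : k ≤ m),
                NCurrent.dot (NCurrent.idealI 𝕜 F (k - 1))
                  (NCurrent.subV (LieModule.toEnd 𝕜 (NCurrent.Sl2 𝕜) V) k)) := by
  refine ⟨fun A _ _ φ _ => ?_, fun m V _ _ _ _ hm hV hdim => ?_⟩
  · rw [NCurrent.current_eq_explicitForm, NCurrent.eq_explicitForm]
  · rw [NCurrent.current_eq_explicitForm, NCurrent.explicitForm_toEnd F hm hV hdim]
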